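/- Let $\mathbb{N}^{<\omega}$ be the set of finite sequences of natural numbers. For a filter $\mathcal{F}$ on $\mathbb{N}$ containing all cofinite sets, let $\tau_{\mathcal{F}}$ be the topology on $\mathbb{N}^{<\omega}$ in which $U$ is open if and only if $\{n\in\mathbb{N} : s^{\smallfrown}n\in U\}\in\mathcal{F}$ for every $s\in U$. For a family $\mathcal{A}$ of subsets of a set $X$ let $\mathcal{A}^{\perp}=\{B\subseteq X : A\cap B \text{ is finite for all } A\in\mathcal{A}\}$; the filter $\mathcal{F}$ is called *Fréchet* if its dual ideal $I=\{A\subseteq\mathbb{N} : \mathbb{N}\setminus A\in\mathcal{F}\}$ satisfies $I=I^{\perp\perp}$. A family of subsets of a countable set $X$ is called Borel (analytic) if it is Borel (analytic) as a subset of the Cantor cube $2^X$, subsets being identified with their characteristic functions; a countable topological space is called Borel (analytic) if its topology is. A space $X$ is *sequential* if every non-closed $A\subseteq X$ contains a sequence converging to a point outside $A$. For $A\subseteq X$ put $A^{(0)}=A$, let $A^{(\alpha+1)}$ be the set of limits of convergent sequences of points of $A^{(\alpha)}$, and $A^{(\lambda)}=\bigcup_{\alpha<\lambda}A^{(\alpha)}$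 for limit $\lambda$; the *sequential order* of $X$ is the least ordinal $\alpha$ such that $A^{(\alpha)}=\overline{A}$ for all $A\subseteq X$. **Corollary.** There is an uncountable family of pairwise non-homeomorphic analytic, indeed Borel, sequential spaces of sequential order $\omega_1$. More precisely, there is an uncountable set $\mathcal{C}$ of proper Fréchet filters on $\mathbb{N}$ that contain all cofinite sets and are analytic, indeed Borel, such that for every $\mathcal{F}\in\mathcal{C}$ the space $(\mathbb{N}^{<\omega},\tau_{\mathcal{F}})$ is an analytic, indeed Borel, sequential space of sequential order $\omega_1$, and for distinct $\mathcal{F},\mathcal{G}\in\mathcal{C}$ the spaces $(\mathbb{N}^{<\omega},\tau_{\mathcal{F}})$ and $(\mathbb{N}^{<\omega},\tau_{\mathcal{G}})$ are not homeomorphic. -/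

import Mathlib

open Set Filter Topology MeasureTheory

/-- A family `𝒜` of subsets of `X`, viewed through characteristic functions as a subset of the
Cantor cube `2^X` (product topology, `Bool` discrete). -/
def cubeSet {X : Type*} (𝒜 : Set (Set X)) : Set (X → Bool) :=
  {χ | {x | χ x = true} ∈ 𝒜}

/-- The family `𝒜` is Borel as a subset of `2^X`. -/
def IsBorelFamily {X : Type*} (𝒜 : Set (Set X)) : Prop :=
  MeasurableSet[borel (X → Bool)] (cubeSet 𝒜)

/-- The family `𝒜` is analytic as a subset of `2^X`. -/
def IsAnalyticFamily {X : Type*} (𝒜 : Set (Set X)) : Prop :=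
  AnalyticSet (cubeSet 𝒜)

/-- The orthogonal of a family: the sets having finite intersection with each of its members. -/
def orthogonal {X : Type*} (𝒜 : Set (Set X)) : Set (Set X) :=
  {B | ∀ A ∈ 𝒜, (A ∩ B).Finite}

/-- The ideal dual to a filter. -/
def dualIdeal {X : Type*} (F : Filter X) : Set (Set X) :=
  {A | Aᶜ ∈ F}

/-- A filter is Fréchet if its dual ideal `I` satisfies `I = I^⊥⊥`. -/
def IsFrechetFilter {X : Type*} (F : Filter X) : Prop :=
  dualIdeal F = orthogonal (orthogonal (dualIdeal F))

/-- The set `ℕ^{<ω}` of finite sequences of natural numbers, to be given the topology `τ_F`. -/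
def SeqSpace (_F : Filter ℕ) : Type := List ℕ

/-- The one-term extension `s⌢n`. -/
def SeqSpace.extend {F : Filter ℕ} (s : SeqSpace F) (n : ℕ) : SeqSpace F :=
  List.append s [n]

/-- The topology `τ_F`: a set `U` is open iff `{n | s⌢n ∈ U} ∈ F` for every `s ∈ U`. -/
instance SeqSpace.instTopologicalSpace (F : Filter ℕ) : TopologicalSpace (SeqSpace F) where
  IsOpen U := ∀ s ∈ U, {n : ℕ | s.extend n ∈ U} ∈ F
  isOpen_univ := fun _ _ => by simp
  isOpen_inter := fun U V hU hV s hs => inter_mem (hU s hs.1) (hV s hs.2)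
  isOpen_sUnion := fun S hS s hs => by
    obtain ⟨U, hU, hsU⟩ := hs
    exact mem_of_superset (hS U hU s hsU) fun n hn => ⟨U, hU, hn⟩

/-- The family of open sets of a space. -/
def openSets (X : Type*) [TopologicalSpace X] : Set (Set X) := {U | IsOpen U}

/-- A Borel space: a countable space whose topology is a Borel subset of `2^X`. -/
def IsBorelTopSpace (X : Type*) [TopologicalSpace X] : Prop :=
  Countable X ∧ IsBorelFamily (openSets X)

/-- An analytic space: a countable space whose topology is an analytic subset of `2^X`. -/
def IsAnalyticTopSpace (X : Type*) [TopologicalSpace X] : Prop :=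
  Countable X ∧ IsAnalyticFamily (openSets X)

/-- Transfinite iteration of the sequential closure: `A` at `0`, the set of limits of sequences
in the previous stage at successors, unions at limits. -/
noncomputable def iterSeqClosure {X : Type*} [TopologicalSpace X] (A : Set X)
    (α : Ordinal.{0}) : Set X :=
  Ordinal.limitRecOn α A (fun _ B => seqClosure B) (fun β _ B => ⋃ γ : Set.Iio β, B γ.1 γ.2)

theorem iterSeqClosure_zero {X : Type*} [TopologicalSpace X] (A : Set X) :
    iterSeqClosure A 0 = A := by
  simp [iterSeqClosure]

theorem iterSeqClosure_succ {X : Type*} [TopologicalSpace X] (A : Set X) (α : Ordinal.{0}) :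
    iterSeqClosure A (Order.succ α) = seqClosure (iterSeqClosure A α) := by
  simp [iterSeqClosure]

theorem iterSeqClosure_limit {X : Type*} [TopologicalSpace X] (A : Set X) {α : Ordinal.{0}}
    (hα : Order.IsSuccLimit α) :
    iterSeqClosure A α = ⋃ γ : Set.Iio α, iterSeqClosure A γ.1 := by
  simp only [iterSeqClosure]
  rw [Ordinal.limitRecOn_limit _ _ _ _ hα]

/-- `X` has sequential order `α`: `α` is the least ordinal such that for every `A ⊆ X` the `α`-th
iterated sequential closure of `A` is the closure of `A`. -/
def HasSequentialOrder (X : Type*) [TopologicalSpace X] (α : Ordinal.{0}) : Prop :=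
  IsLeast {β : Ordinal.{0} | ∀ A : Set X, iterSeqClosure A β = closure A} α

/-! For every proper Fréchet filter containing the cofinite sets, the space has the required order.
One step of sequential closure is governed by the ideal at each node: a point `s` outside `A` is a
limit of a sequence from `A` exactly when the set of `n` with `s⌢n ∈ A` is not in the ideal
(`SeqSpace.mem_seqClosure_iff`). This gives sequentiality, and grafting sets of growing rank above
the children of the root pushes the order up to `ω₁`.

It remains to find uncountably many filters. Write `(I_α, J_α)` for `orthPair α`: mutually
orthogonal Borel families, starting with (all sets, finite sets). For `0 < α < ω₁` they are built by
spreading all earlier pairs, swapped, over the columns of `ℕ × ℕ`. The filters are the duals of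
`J_α`.

A homeomorphism from the space of `β` to that of `α < β` would match the two ideals at the root and
its image, off a set `E ∈ J_β` (`SeqSpace.exists_of_homeomorph`). Since `E` meets finitely many
columns and `α` labels infinitely many, some column of `J_β`, carrying a copy of `I_α`, embeds into
`J_α`. So `(J_α, I_α)` embeds into `(I_α, J_α)`. Descent on rank excludes this (`not_embeds_swap`);
finite sums of pairs are allowed as targets to keep the induction going. -/

/-! ### Orthogonal pairs and column sums -/

theorem orthogonal_anti_mem {X : Type*} {𝒜 : Set (Set X)} {A B : Set X} (hAB : A ⊆ B)
    (hB : B ∈ orthogonal 𝒜) : A ∈ orthogonal 𝒜 := fun C hC => (hB C hC).subset (inter_subset_inter_right C hAB)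

theorem finite_mem_orthogonal {X : Type*} {𝒜 : Set (Set X)} {A : Set X} (hA : A.Finite) :
    A ∈ orthogonal 𝒜 := fun _ _ => hA.subset inter_subset_right

theorem subset_orthogonal_orthogonal {X : Type*} (𝒜 : Set (Set X)) :
    𝒜 ⊆ orthogonal (orthogonal 𝒜) := fun A hA B hB => by
  rw [inter_comm]; exact hB A hA

theorem orthogonal_antitone {X : Type*} {𝒜 ℬ : Set (Set X)} (h : 𝒜 ⊆ ℬ) :
    orthogonal ℬ ⊆ orthogonal 𝒜 := fun _ hB A hA => hB A (h hA)

theorem orthogonal_triple {X : Type*} (𝒜 : Set (Set X)) :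
    orthogonal (orthogonal (orthogonal 𝒜)) = orthogonal 𝒜 :=
  (orthogonal_antitone (subset_orthogonal_orthogonal 𝒜)).antisymm
    (subset_orthogonal_orthogonal _)

/-- A pair of families each of which is the orthogonal of the other. -/
structure IsOrthPair {X : Type*} (I J : Set (Set X)) : Prop where
  snd_eq : J = orthogonal I
  fst_eq : I = orthogonal J

namespace IsOrthPair

variable {X : Type*} {I J : Set (Set X)}

theorem symm (h : IsOrthPair I J) : IsOrthPair J I := ⟨h.fst_eq, h.snd_eq⟩

theorem mono (h : IsOrthPair I J) {A B : Set X} (hAB : A ⊆ B) (hB : B ∈ I) : A ∈ I := by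
  rw [h.fst_eq] at hB ⊢
  exact orthogonal_anti_mem hAB hB

theorem of_finite (h : IsOrthPair I J) {A : Set X} (hA : A.Finite) : A ∈ I := by
  rw [h.fst_eq]
  exact finite_mem_orthogonal hA

end IsOrthPair

/-- The `n`-th column of a set of natural numbers, `ℕ` being identified with `ℕ × ℕ`. -/
def column (n : ℕ) (A : Set ℕ) : Set ℕ := {m | Nat.pair n m ∈ A}

/-- The sets all of whose columns belong to the given families. -/
def columnSum (I : ℕ → Set (Set ℕ)) : Set (Set ℕ) := {A | ∀ n, column n A ∈ I n}

/-- The sets with finitely many nonempty columns, all belonging to the given families. -/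
def finColumnSum (I : ℕ → Set (Set ℕ)) : Set (Set ℕ) :=
  {A | (∀ n, column n A ∈ I n) ∧ {n | (column n A).Nonempty}.Finite}

theorem column_image_pair_self (k : ℕ) (A : Set ℕ) : column k (Nat.pair k '' A) = A := by
  ext m
  simp [column, Nat.pair_eq_pair]

theorem column_image_pair_of_ne {k n : ℕ} (h : n ≠ k) (A : Set ℕ) :
    column n (Nat.pair k '' A) = ∅ := by
  ext m
  simp [column, Nat.pair_eq_pair, h.symm]

theorem image_pair_mem_columnSum {I J : ℕ → Set (Set ℕ)} (h : ∀ n, IsOrthPair (I n) (J n))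
    {k : ℕ} {A : Set ℕ} (hA : A ∈ I k) : Nat.pair k '' A ∈ columnSum I := by
  intro n
  rcases eq_or_ne n k with rfl | hn
  · rwa [column_image_pair_self]
  · rw [column_image_pair_of_ne hn]
    exact (h n).of_finite finite_empty

theorem image_pair_mem_finColumnSum {I J : ℕ → Set (Set ℕ)} (h : ∀ n, IsOrthPair (I n) (J n))
    {k : ℕ} {A : Set ℕ} (hA : A ∈ I k) : Nat.pair k '' A ∈ finColumnSum I := by
  refine ⟨image_pair_mem_columnSum h hA, (finite_singleton k).subset fun n hn => ?_⟩
  by_contra hne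
  simp [column_image_pair_of_ne hne] at hn

theorem finite_of_finite_columns {A : Set ℕ} (h : {n | (column n A).Nonempty}.Finite)
    (h' : ∀ n, (column n A).Finite) : A.Finite := by
  refine (h.biUnion fun n _ => (h' n).image (Nat.pair n)).subset fun x hx => ?_
  have hx' : x.unpair.2 ∈ column x.unpair.1 A := by simpa [column] using hx
  exact mem_biUnion (show x.unpair.1 ∈ {n | (column n A).Nonempty} from ⟨_, hx'⟩)
    ⟨_, hx', by simp⟩

/-- Copies of members of `I k` or `J k` inside a single column test the columns one at a time;
selectors, with at most one point per column, bound the number of nonempty columns. -/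
theorem IsOrthPair.columnSum {I J : ℕ → Set (Set ℕ)} (h : ∀ n, IsOrthPair (I n) (J n)) :
    IsOrthPair (columnSum I) (finColumnSum J) := by
  have hfin : ∀ A ∈ _root_.columnSum I, ∀ B ∈ finColumnSum J, (A ∩ B).Finite := by
    intro A hA B hB
    refine finite_of_finite_columns (hB.2.subset fun n hn => hn.mono fun m hm => hm.2) fun n => ?_
    have hBn := hB.1 n
    rw [(h n).snd_eq] at hBn
    exact hBn _ (hA n)
  constructor
  · refine Subset.antisymm (fun B hB A hA => hfin A hA B hB) fun B hB => ⟨fun n => ?_, ?_⟩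
    · rw [(h n).snd_eq]
      intro A hA
      refine Finite.of_finite_image (f := Nat.pair n)
        ((hB _ (image_pair_mem_columnSum h hA)).subset ?_) fun a _ b _ hab => ?_
      · rintro _ ⟨m, hm, rfl⟩
        exact ⟨⟨m, hm.1, rfl⟩, hm.2⟩
      · exact (Nat.pair_eq_pair.1 hab).2
    · set S := {n | (column n B).Nonempty}
      choose! f hf using show ∀ n ∈ S, ∃ m, m ∈ column n B from fun n hn => hn
      have hA : (fun n => Nat.pair n (f n)) '' S ∈ _root_.columnSum I := by
        refine fun n => (h n).of_finite ((finite_singleton (f n)).subset ?_)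
        rintro m ⟨k, -, hk⟩
        obtain ⟨rfl, rfl⟩ := Nat.pair_eq_pair.1 hk
        rfl
      refine Finite.of_finite_image (f := fun n => Nat.pair n (f n)) ((hB _ hA).subset ?_) fun a _ b _ hab =>
        (Nat.pair_eq_pair.1 hab).1
      exact subset_inter Subset.rfl (image_subset_iff.2 fun n hn => hf n hn)
  · refine Subset.antisymm (fun A hA B hB => ?_) fun A hA n => ?_
    · rw [inter_comm]
      exact hfin A hA B hB
    · rw [(h n).fst_eq]
      intro B hB
      refine Finite.of_finite_image (f := Nat.pair n)
        ((hA _ (image_pair_mem_finColumnSum (fun n => (h n).symm) hB)).subset ?_)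
        fun a _ b _ hab => ?_
      · rintro _ ⟨m, hm, rfl⟩
        exact ⟨⟨m, hm.1, rfl⟩, hm.2⟩
      · exact (Nat.pair_eq_pair.1 hab).2

theorem isOrthPair_univ_finite (X : Type*) : IsOrthPair (univ : Set (Set X)) {A | A.Finite} := by
  constructor
  · ext A
    refine ⟨fun hA => finite_mem_orthogonal hA, fun hA => ?_⟩
    simpa using hA univ (mem_univ _)
  · ext A
    exact ⟨fun _ B hB => hB.subset inter_subset_left, fun _ => mem_univ _⟩

/-! ### The transfinite sequence of pairs -/

open Classical in
/-- A transfinite sequence of orthogonal pairs: the first family of the `α`-th pair is the sum over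
all columns of the second families of earlier pairs, each of which occurs infinitely often. -/
noncomputable def orthPair (α : Ordinal.{0}) : Set (Set ℕ) × Set (Set ℕ) :=
  if h : ∃ f : ℕ → Iio α, ∀ b, {n | f n = b}.Infinite then
    (columnSum fun n => (orthPair (h.choose n)).2, finColumnSum fun n => (orthPair (h.choose n)).1)
  else (univ, {A | A.Finite})
termination_by α
decreasing_by all_goals exact (h.choose n).2

/-- The default pair occurs at `α = 0` and at uncountable `α`, where no such enumeration exists. -/
theorem orthPair_cases (α : Ordinal.{0}) :
    (∃ f : ℕ → Ordinal.{0}, (∀ n, f n < α) ∧ (∀ b < α, {n | f n = b}.Infinite) ∧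
      orthPair α = (columnSum fun n => (orthPair (f n)).2,
        finColumnSum fun n => (orthPair (f n)).1)) ∨
    ((¬ ∃ f : ℕ → Iio α, ∀ b, {n | f n = b}.Infinite) ∧
      orthPair α = (univ, {A | A.Finite})) := by
  by_cases h : ∃ f : ℕ → Iio α, ∀ b, {n | f n = b}.Infinite
  · refine Or.inl ⟨fun n => h.choose n, fun n => (h.choose n).2, fun b hb => ?_, ?_⟩
    · convert h.choose_spec ⟨b, hb⟩ using 3
      simp [Subtype.ext_iff]
    · rw [orthPair, dif_pos h]
  · refine Or.inr ⟨h, ?_⟩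
    rw [orthPair, dif_neg h]

theorem isOrthPair_orthPair (α : Ordinal.{0}) : IsOrthPair (orthPair α).1 (orthPair α).2 := by
  induction α using WellFoundedLT.induction with
  | ind α ih =>
    rcases orthPair_cases α with ⟨f, hf, -, hα⟩ | ⟨-, hα⟩ <;> rw [hα]
    · exact IsOrthPair.columnSum fun n => (ih _ (hf n)).symm
    · exact isOrthPair_univ_finite ℕ

theorem univ_notMem_orthPair_snd (α : Ordinal.{0}) : (univ : Set ℕ) ∉ (orthPair α).2 := by
  rcases orthPair_cases α with ⟨f, hf, -, hα⟩ | ⟨-, hα⟩ <;> rw [hα]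
  · intro h
    have := h.2
    simp [column, infinite_univ.not_finite] at this
  · exact infinite_univ

theorem countable_Iio_of_lt_omega_one {α : Ordinal.{0}} (hα : α < Ordinal.omega 1) :
    Countable (Iio α) := by
  rw [← Cardinal.mk_le_aleph0_iff, Cardinal.mk_Iio_ordinal, ← Cardinal.lift_aleph0.{1, 0},
    Cardinal.lift_le, ← Order.lt_succ_iff, Cardinal.succ_aleph0]
  rwa [← Cardinal.lt_ord, Cardinal.ord_aleph]

theorem orthPair_eq_columnSum {α : Ordinal.{0}} (h0 : α ≠ 0) (hα : α < Ordinal.omega 1) :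
    ∃ f : ℕ → Ordinal.{0}, (∀ n, f n < α) ∧ (∀ b < α, {n | f n = b}.Infinite) ∧
      orthPair α = (columnSum fun n => (orthPair (f n)).2,
        finColumnSum fun n => (orthPair (f n)).1) := by
  refine (orthPair_cases α).resolve_right fun h => h.1 ?_
  have := countable_Iio_of_lt_omega_one hα
  have : Nonempty (Iio α) := ⟨⟨0, pos_iff_ne_zero.2 h0⟩⟩
  obtain ⟨g, hg⟩ := exists_surjective_nat (Iio α)
  -- Reading only the first coordinate of `n` repeats every value of `g` infinitely often.
  refine ⟨fun n => g n.unpair.1, fun b => ?_⟩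
  obtain ⟨k, rfl⟩ := hg b
  refine (infinite_range_of_injective (f := Nat.pair k)
    fun a b hab => (Nat.pair_eq_pair.1 hab).2).mono ?_
  rintro _ ⟨m, rfl⟩
  simp

theorem orthPair_zero : orthPair 0 = (univ, {A | A.Finite}) := by
  rcases orthPair_cases 0 with ⟨f, hf, -⟩ | ⟨-, h⟩
  · exact absurd (hf 0) not_lt_zero
  · exact h

/-! ### Swapped pairs do not embed -/

/-- The `γ`-th pair is a sum of swapped pairs of ranks smaller than `α`, whenever `γ ≤ α ≠ 0`. -/
theorem orthPair_decompose {α γ : Ordinal.{0}} (h0 : α ≠ 0) (hγ : γ ≤ α) :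
    ∃ (κ ρ : ℕ → ℕ) (δ : ℕ → Ordinal.{0}), (Function.Injective fun y => (κ y, ρ y)) ∧
      (∀ n, δ n < α) ∧
      (∀ B ∈ (orthPair γ).1, ∀ n, ρ '' {y ∈ B | κ y = n} ∈ (orthPair (δ n)).2) ∧
      (∀ B ∈ (orthPair γ).2, (κ '' B).Finite ∧
        ∀ n, ρ '' {y ∈ B | κ y = n} ∈ (orthPair (δ n)).1) := by
  rcases orthPair_cases γ with ⟨f, hf, -, hγe⟩ | ⟨-, hγe⟩
  · have key : ∀ (B : Set ℕ) n,
        (fun y : ℕ => y.unpair.2) '' {y ∈ B | y.unpair.1 = n} = column n B := by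
      intro B n
      ext m
      constructor
      · rintro ⟨y, ⟨hy, rfl⟩, rfl⟩
        simpa [column] using hy
      · intro hm
        exact ⟨Nat.pair n m, ⟨hm, by simp⟩, by simp⟩
    refine ⟨fun y => y.unpair.1, fun y => y.unpair.2, f, fun a b hab => ?_,
      fun n => (hf n).trans_le hγ, fun B hB n => ?_, fun B hB => ⟨?_, fun n => ?_⟩⟩
    · have hab' : Nat.unpair a = Nat.unpair b := Prod.ext (Prod.ext_iff.1 hab).1 (Prod.ext_iff.1 hab).2
      rw [← Nat.pair_unpair a, ← Nat.pair_unpair b, hab']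
    · rw [hγe] at hB
      rw [key]
      exact hB n
    · rw [hγe] at hB
      refine hB.2.subset ?_
      rintro _ ⟨y, hy, rfl⟩
      exact ⟨y.unpair.2, by simpa [column] using hy⟩
    · rw [hγe] at hB
      rw [key]
      exact hB.1 n
  · have hfin : ∀ (B : Set ℕ) n, ((fun _ : ℕ => 0) '' {y ∈ B | y = n}).Finite := fun B n =>
      (finite_singleton 0).subset (by rintro _ ⟨_, _, rfl⟩; rfl)
    -- For the pair (all sets, finite sets) each point is its own column, of rank `0`; this is where
    -- `α ≠ 0` is needed.
    refine ⟨fun y => y, fun _ => 0, fun _ => 0, fun a b hab => (Prod.ext_iff.1 hab).1,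
      fun n => pos_iff_ne_zero.2 h0, fun B _ n => (isOrthPair_orthPair 0).symm.of_finite (hfin B n),
      fun B hB => ⟨?_, fun n => (isOrthPair_orthPair 0).of_finite (hfin B n)⟩⟩
    rw [hγe] at hB
    simpa using hB

/-- If `g` is finite-valued on every set of the first family of a column sum, then almost all
columns are mapped into a common finite set. -/
theorem exists_finite_of_columnSum {β : Type*} {I J : ℕ → Set (Set ℕ)}
    (hIJ : ∀ n, IsOrthPair (I n) (J n)) {g : ℕ → β}
    (hg : ∀ A ∈ columnSum I, (g '' A).Finite) :
    ∃ (k₀ : ℕ) (N : Finset β), ∀ k ≥ k₀, ∀ m, g (Nat.pair k m) ∈ N := by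
  classical
  by_contra! hcon
  -- Points in strictly increasing columns with distinct `g`-values: their set is a selector, hence
  -- in the column sum, yet has infinite image.
  obtain ⟨f, -, hf⟩ := exists_seq_of_forall_finset_exists (fun _ : ℕ => True)
    (fun x y => x.unpair.1 < y.unpair.1 ∧ g x ≠ g y) (fun s _ => by
      obtain ⟨k, hk, m, hm⟩ := hcon (s.sup (fun x => x.unpair.1) + 1) (s.image g)
      refine ⟨Nat.pair k m, trivial, fun x hx => ⟨?_, fun hxy => hm ?_⟩⟩
      · have := Finset.le_sup (f := fun x : ℕ => x.unpair.1) hx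
        simp only [Nat.unpair_pair] at this ⊢
        omega
      · exact hxy ▸ Finset.mem_image_of_mem g hx)
  have hinj : Function.Injective (g ∘ f) := fun m n hmn => by
    rcases lt_trichotomy m n with h | h | h
    · exact absurd hmn (hf m n h).2
    · exact h
    · exact absurd hmn.symm (hf n m h).2
  have hA : range f ∈ columnSum I := by
    refine fun n => (hIJ n).of_finite (Set.Subsingleton.finite ?_)
    rintro a ⟨i, hi⟩ b ⟨j, hj⟩
    rcases lt_trichotomy i j with h | rfl | h
    · have := (hf i j h).1
      simp [hi, hj] at this
    · exact (Nat.pair_eq_pair.1 (hi.symm.trans hj)).2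
    · have := (hf j i h).1
      simp [hi, hj] at this
  have := hg _ hA
  rw [← range_comp] at this
  exact infinite_range_of_injective hinj this

/-- The swapped `α`-th pair does not embed into a finite sum of pairs of ranks at most `α`. -/
theorem not_embeds_swap (α : Ordinal.{0}) (hα : α < Ordinal.omega 1) {ι : Type} [Finite ι]
    (c : ι → Ordinal.{0}) (hc : ∀ i, c i ≤ α) (φ : ℕ → ι × ℕ) (hφ : Function.Injective φ)
    (h₁ : ∀ A ∈ (orthPair α).1, ∀ i, {y | (i, y) ∈ φ '' A} ∈ (orthPair (c i)).2)
    (h₂ : ∀ A ∈ (orthPair α).2, ∀ i, {y | (i, y) ∈ φ '' A} ∈ (orthPair (c i)).1) : False := by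
  induction α using WellFoundedLT.induction generalizing ι with
  | ind α ih =>
  rcases eq_or_ne α 0 with rfl | h0
  · have hfin : ∀ i, {y | (i, y) ∈ range φ}.Finite := by
      intro i
      have := h₁ univ (by rw [orthPair_zero]; exact mem_univ _) i
      rw [nonpos_iff_eq_zero.1 (hc i), orthPair_zero, image_univ] at this
      exact this
    refine infinite_range_of_injective hφ
      ((finite_iUnion fun i => (hfin i).image (Prod.mk i)).subset ?_)
    rintro ⟨i, y⟩ hx
    exact mem_iUnion.2 ⟨i, y, hx, rfl⟩
  · obtain ⟨f, hf, hinf, hαe⟩ := orthPair_eq_columnSum h0 hα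
    choose κ ρ δ hinj hδ hd₁ hd₂ using fun i => orthPair_decompose h0 (hc i)
    have hpair := fun n => isOrthPair_orthPair (f n)
    -- The map `g` records the summand and column hit by `φ x`. Sets in the first family go to
    -- second-family sets, which meet finitely many columns, so `g` is finite-valued on them.
    obtain ⟨k₀, N, hN⟩ := exists_finite_of_columnSum (fun n => (hpair n).symm)
      (g := fun x => ((φ x).1, κ (φ x).1 (φ x).2)) (fun A hA => by
        refine (finite_iUnion fun i => (hd₂ i _ (h₁ A (by rw [hαe]; exact hA) i)).1.image
          (Prod.mk i)).subset ?_
        rintro _ ⟨x, hx, rfl⟩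
        exact mem_iUnion.2 ⟨(φ x).1, _, ⟨(φ x).2, ⟨x, hx, rfl⟩, rfl⟩, rfl⟩)
    -- The largest rank `b` among the finitely many target columns still labels a column `k` beyond
    -- `k₀`. Restricting `φ` to it embeds the swapped `b`-th pair into a finite sum of ranks at most
    -- `b < α`.
    have hb : N.sup (fun p => δ p.1 p.2) < α := by
      rw [Finset.sup_lt_iff (pos_iff_ne_zero.2 h0)]
      exact fun p _ => hδ p.1 p.2
    obtain ⟨k, hk, hkk⟩ := (hinf _ hb).exists_gt k₀
    have hNk := fun m => hN k hkk.le m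
    have hsub : ∀ (A : Set ℕ) (p : N),
        {y | (p, y) ∈ (fun m => ((⟨_, hNk m⟩ : N),
          ρ (φ (Nat.pair k m)).1 (φ (Nat.pair k m)).2)) '' A} ⊆
        ρ p.1.1 '' {y ∈ {y | (p.1.1, y) ∈ φ '' (Nat.pair k '' A)} | κ p.1.1 y = p.1.2} := by
      rintro A ⟨⟨i, n⟩, hp⟩ z ⟨m, hm, hmz⟩
      simp only [Prod.mk.injEq, Subtype.mk.injEq] at hmz
      obtain ⟨⟨rfl, rfl⟩, rfl⟩ := hmz
      exact ⟨_, ⟨⟨_, ⟨m, hm, rfl⟩, rfl⟩, rfl⟩, rfl⟩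
    refine ih _ hb (hb.trans hα) (ι := N) (fun p => δ p.1.1 p.1.2)
      (fun p => Finset.le_sup (f := fun p : ι × ℕ => δ p.1 p.2) p.2)
      (fun m => (⟨_, hNk m⟩, ρ (φ (Nat.pair k m)).1 (φ (Nat.pair k m)).2)) ?_ ?_ ?_
    · intro a b hab
      simp only [Prod.mk.injEq, Subtype.mk.injEq] at hab
      obtain ⟨⟨hi, hn⟩, hz⟩ := hab
      rw [← hi] at hn hz
      have h2 := hinj _ (Prod.ext hn hz : (_, _) = (_, _))
      exact (Nat.pair_eq_pair.1 (hφ (Prod.ext hi h2))).2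
    · intro A hA p
      have hA' : Nat.pair k '' A ∈ (orthPair α).2 := by
        rw [hαe]
        exact image_pair_mem_finColumnSum hpair (by rw [hk]; exact hA)
      exact (isOrthPair_orthPair _).symm.mono (hsub A p) (hd₁ _ _ (h₂ _ hA' p.1.1) p.1.2)
    · intro A hA p
      have hA' : Nat.pair k '' A ∈ (orthPair α).1 := by
        rw [hαe]
        exact image_pair_mem_columnSum (fun n => (hpair n).symm) (by rw [hk]; exact hA)
      exact (isOrthPair_orthPair _).mono (hsub A p) ((hd₂ _ _ (h₁ _ hA' p.1.1)).2 p.1.2)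

/-! ### Convergence in the sequence space -/

namespace SeqSpace

variable {F : Filter ℕ}

instance (F : Filter ℕ) : Countable (SeqSpace F) := inferInstanceAs (Countable (List ℕ))

/-- The empty sequence. -/
def root (F : Filter ℕ) : SeqSpace F := ([] : List ℕ)

/-- The sequence `s` with the term `n` put in front. -/
def prepend (n : ℕ) (s : SeqSpace F) : SeqSpace F := List.cons n s

theorem root_ne_prepend (n : ℕ) (s : SeqSpace F) : root F ≠ prepend n s :=
  (List.cons_ne_nil n s).symm

theorem extend_injective (s : SeqSpace F) : Function.Injective s.extend := fun a b hab => by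
  simpa using List.append_cancel_left hab

theorem isClosed_iff {A : Set (SeqSpace F)} :
    IsClosed A ↔ ∀ s ∉ A, {n : ℕ | s.extend n ∈ A} ∈ dualIdeal F := by
  rw [← isOpen_compl_iff]; rfl

theorem dualIdeal_mono {A B : Set ℕ} (hAB : A ⊆ B) (hB : B ∈ dualIdeal F) : A ∈ dualIdeal F :=
  mem_of_superset hB (compl_subset_compl.2 hAB)

theorem finite_mem_dualIdeal (hF : F ≤ cofinite) {A : Set ℕ} (hA : A.Finite) : A ∈ dualIdeal F :=
  hF hA.compl_mem_cofinite

theorem isClosed_setOf_prefix (hF : F ≤ cofinite) (t : SeqSpace F) :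
    IsClosed {x : SeqSpace F | List.IsPrefix t x} := by
  refine isClosed_iff.2 fun x hx => finite_mem_dualIdeal hF (Set.Subsingleton.finite ?_)
  intro a ha b hb
  have ha' := (List.prefix_concat_iff.1 ha).resolve_right hx
  have hb' := (List.prefix_concat_iff.1 hb).resolve_right hx
  exact extend_injective x (ha'.symm.trans hb')

theorem isOpen_setOf_prefix (t : SeqSpace F) : IsOpen {x : SeqSpace F | List.IsPrefix t x} :=
  fun x hx => by
    convert univ_mem
    exact eq_univ_of_forall fun n => List.prefix_concat_iff.2 (Or.inr hx)

theorem tendsto_extend {s : SeqSpace F} {B : Set ℕ} (hB : B ∈ orthogonal (dualIdeal F))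
    {e : ℕ → ℕ} (he : Function.Injective e) (heB : ∀ k, e k ∈ B) :
    Tendsto (fun k => s.extend (e k)) atTop (𝓝 s) := by
  rw [(nhds_basis_opens s).tendsto_right_iff]
  rintro U ⟨hsU, hU⟩
  have hC : {n | s.extend n ∈ U}ᶜ ∈ dualIdeal F := by
    rw [dualIdeal, mem_ofPred_eq, compl_compl]
    exact hU s hsU
  have hfin := (hB _ hC).preimage he.injOn
  rw [← Nat.cofinite_eq_atTop]
  filter_upwards [hfin.compl_mem_cofinite] with k hk
  by_contra hcon
  exact hk ⟨hcon, heB k⟩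

/-- If the children of `s` in `A` form a set in the ideal, a tail of a sequence from `A` tending to
`s` would be closed and miss `s`. Conversely, by `I = I^⊥⊥`, a set outside `I` meets some `B ∈ I^⊥`
infinitely often, and enumerating the intersection gives a sequence tending to `s`. -/
theorem mem_seqClosure_iff (hF : F ≤ cofinite) (hFr : IsFrechetFilter F) {A : Set (SeqSpace F)}
    {s : SeqSpace F} :
    s ∈ seqClosure A ↔ s ∈ A ∨ {n | s.extend n ∈ A} ∉ dualIdeal F := by
  constructor
  · rintro ⟨x, hxA, hx⟩
    by_contra! hcon
    obtain ⟨hsA, hC⟩ := hcon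
    obtain ⟨K, hK⟩ := eventually_atTop.1
      (hx.eventually ((isOpen_setOf_prefix s).mem_nhds (List.prefix_refl s)))
    -- Three kinds of node `t`: at `s` the assumption applies; a proper prefix of `s` has no child
    -- in the tail, which lies above `s` and avoids `s`; any other `t` has only finitely many terms
    -- above it.
    have hcl : IsClosed (x '' Ici K) := by
      refine isClosed_iff.2 fun t ht => ?_
      by_cases hts : List.IsPrefix t s
      · rcases eq_or_ne t s with rfl | hne
        · refine dualIdeal_mono ?_ hC
          rintro n ⟨k, -, hk⟩
          have := hxA k
          rwa [hk] at this
        · convert finite_mem_dualIdeal hF finite_empty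
          refine eq_empty_of_forall_notMem ?_
          rintro n ⟨k, hk, hkn⟩
          have h1 : List.IsPrefix s (t.extend n) := hkn ▸ hK k hk
          rcases List.prefix_concat_iff.1 h1 with h2 | h2
          · have h3 : s = x k := h2.trans hkn.symm
            exact hsA (h3 ▸ hxA k)
          · exact hne (hts.eq_of_length_le h2.length_le)
      · obtain ⟨M, hM⟩ := eventually_atTop.1
          (hx.eventually ((isClosed_setOf_prefix hF t).isOpen_compl.mem_nhds hts))
        refine finite_mem_dualIdeal hF (Finite.of_finite_image (f := t.extend)
          (((finite_Iio M).image x).subset ?_) (extend_injective t).injOn)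
        rintro _ ⟨n, ⟨k, hk, hkn⟩, rfl⟩
        refine ⟨k, ?_, hkn⟩
        by_contra hkM
        refine hM k (not_lt.1 hkM) ?_
        rw [hkn]
        exact List.prefix_append t [n]
    have hs : s ∈ (x '' Ici K)ᶜ := by
      rintro ⟨k, -, hk⟩
      exact hsA (hk ▸ hxA k)
    obtain ⟨k, hk, hkK⟩ := ((hx.eventually (hcl.isOpen_compl.mem_nhds hs)).and
      (eventually_ge_atTop K)).exists
    exact hk ⟨k, hkK, rfl⟩
  · rintro (h | h)
    · exact subset_seqClosure h
    · rw [hFr] at h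
      simp only [orthogonal, mem_ofPred_eq, not_forall] at h
      obtain ⟨B, hB, hinf⟩ := h
      let e := Set.Infinite.natEmbedding _ hinf
      exact ⟨fun k => s.extend (e k), fun k => (e k).2.2,
        tendsto_extend (B := B) hB (Subtype.val_injective.comp e.injective) fun k => (e k).2.1⟩

theorem sequentialSpace (hF : F ≤ cofinite) (hFr : IsFrechetFilter F) :
    SequentialSpace (SeqSpace F) := by
  refine ⟨fun A hA => isClosed_iff.2 fun s hs => ?_⟩
  by_contra hcon
  have := (mem_seqClosure_iff hF hFr).2 (Or.inr hcon)
  rw [hA.seqClosure_eq] at this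
  exact hs this

end SeqSpace

/-! ### Sequential order -/

section IterSeqClosure

variable {X : Type*} [TopologicalSpace X]

theorem iterSeqClosure_add_one (A : Set X) (α : Ordinal.{0}) :
    iterSeqClosure A (α + 1) = seqClosure (iterSeqClosure A α) :=
  iterSeqClosure_succ A α

theorem iterSeqClosure_mono (A : Set X) {α β : Ordinal.{0}} (h : α ≤ β) :
    iterSeqClosure A α ⊆ iterSeqClosure A β := by
  induction β using Ordinal.limitRecOn with
  | zero => rw [nonpos_iff_eq_zero.1 h]
  | add_one β ih =>
    rcases h.lt_or_eq with h | rfl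
    · rw [iterSeqClosure_add_one]
      exact (ih (Order.lt_add_one_iff.1 h)).trans subset_seqClosure
    · rfl
  | limit β hβ ih =>
    rcases h.lt_or_eq with h | rfl
    · rw [iterSeqClosure_limit A hβ]
      exact subset_iUnion (fun γ : Iio β => iterSeqClosure A γ.1) ⟨α, h⟩
    · rfl

theorem iterSeqClosure_subset_closure (A : Set X) (α : Ordinal.{0}) :
    iterSeqClosure A α ⊆ closure A := by
  induction α using Ordinal.limitRecOn with
  | zero => rw [iterSeqClosure_zero]; exact subset_closure
  | add_one α ih =>
    rw [iterSeqClosure_add_one]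
    exact seqClosure_subset_closure.trans (closure_minimal ih isClosed_closure)
  | limit α hα ih =>
    rw [iterSeqClosure_limit A hα]
    exact iUnion_subset fun γ => ih γ.1 γ.2

/-- Countably many stages below `ω₁` have a supremum below `ω₁`, so the union of these stages is
sequentially closed. -/
theorem iterSeqClosure_omega_one [SequentialSpace X] (A : Set X) :
    iterSeqClosure A (Ordinal.omega 1) = closure A := by
  refine (iterSeqClosure_subset_closure A _).antisymm (closure_minimal ?_ ?_)
  · conv_lhs => rw [← iterSeqClosure_zero A]
    exact iterSeqClosure_mono A zero_le
  · refine IsSeqClosed.isClosed fun x p hx hp => ?_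
    have hlim := Cardinal.isSuccLimit_omega 1
    simp only [iterSeqClosure_limit A hlim, mem_iUnion] at hx
    choose γ hγ using hx
    have hsup : (⨆ k, (γ k).1) < Ordinal.omega 1 := Ordinal.iSup_lt_omega_one fun k => (γ k).2
    refine iterSeqClosure_mono A (hlim.add_one_lt hsup).le ?_
    rw [iterSeqClosure_add_one]
    exact ⟨x, fun k => iterSeqClosure_mono A (Ordinal.le_iSup _ k) (hγ k), hp⟩

end IterSeqClosure

namespace SeqSpace

variable {F : Filter ℕ}

theorem continuous_prepend (n : ℕ) : Continuous (prepend (F := F) n) :=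
  ⟨fun _ hU s hs => hU (prepend n s) hs⟩

theorem prepend_mem_iterSeqClosure (hF : F ≤ cofinite) (hFr : IsFrechetFilter F)
    {A : Set (SeqSpace F)} {n : ℕ} {s : SeqSpace F} {β : Ordinal.{0}}
    (h : prepend n s ∈ iterSeqClosure A β) : s ∈ iterSeqClosure (prepend n ⁻¹' A) β := by
  induction β using Ordinal.limitRecOn generalizing s with
  | zero => rwa [iterSeqClosure_zero] at h ⊢
  | add_one β ih =>
    rw [iterSeqClosure_add_one, mem_seqClosure_iff hF hFr] at h ⊢
    exact h.imp ih (mt (dualIdeal_mono fun m hm => ih hm))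
  | limit β hβ ih =>
    rw [iterSeqClosure_limit _ hβ, mem_iUnion] at h ⊢
    exact h.imp fun γ hγ => ih γ.1 γ.2 hγ

/-- The root can enter only at a successor stage, and then its children already present form a set
outside the ideal, hence infinite. -/
theorem root_mem_iterSeqClosure (hF : F ≤ cofinite) (hFr : IsFrechetFilter F)
    {A : Set (SeqSpace F)} (hA : root F ∉ A) {β : Ordinal.{0}}
    (h : root F ∈ iterSeqClosure A β) :
    ∃ γ < β, {n | prepend n (root F) ∈ iterSeqClosure A γ}.Infinite := by
  induction β using Ordinal.limitRecOn with
  | zero => rw [iterSeqClosure_zero] at h; exact absurd h hA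
  | add_one β ih =>
    rw [iterSeqClosure_add_one, mem_seqClosure_iff hF hFr] at h
    rcases h with h | h
    · obtain ⟨γ, hγ, hinf⟩ := ih h
      exact ⟨γ, hγ.trans (Order.lt_succ β), hinf⟩
    · exact ⟨β, Order.lt_succ β, fun hfin => h (finite_mem_dualIdeal hF hfin)⟩
  | limit β hβ ih =>
    rw [iterSeqClosure_limit _ hβ, mem_iUnion] at h
    obtain ⟨γ, hγ⟩ := h
    obtain ⟨δ, hδ, hinf⟩ := ih γ.1 γ.2 hγ
    exact ⟨δ, hδ.trans γ.2, hinf⟩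

theorem exists_root_notMem_iterSeqClosure [F.NeBot] (hF : F ≤ cofinite) (hFr : IsFrechetFilter F)
    {α : Ordinal.{0}} (hα : Countable (Iio α)) :
    ∃ A : Set (SeqSpace F), root F ∈ closure A ∧ root F ∉ iterSeqClosure A α := by
  induction α using WellFoundedLT.induction with
  | ind α ih =>
  have hA : ∃ A : ℕ → Set (SeqSpace F), (∀ n, root F ∈ closure (A n)) ∧
      ∀ γ < α, {n | root F ∈ iterSeqClosure (A n) γ}.Finite := by
    rcases eq_or_ne α 0 with rfl | h0
    · exact ⟨fun _ => univ, by simp, fun γ hγ => absurd hγ not_lt_zero⟩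
    · have : Nonempty (Iio α) := ⟨⟨0, pos_iff_ne_zero.2 h0⟩⟩
      obtain ⟨f, hf⟩ := exists_surjective_nat (Iio α)
      -- The set above child `n` is chosen to delay its root past the first `n + 1` ordinals of an
      -- enumeration of `α`, so each stage `γ < α` captures only finitely many children.
      have hsup : ∀ n, (Finset.range (n + 1)).sup (fun i => (f i).1) < α := fun n => by
        rw [Finset.sup_lt_iff (pos_iff_ne_zero.2 h0)]
        exact fun i _ => (f i).2
      have hcount : ∀ β < α, Countable (Iio β) := fun β hβ =>
        (Set.countable_coe_iff.1 hα).mono (Iio_subset_Iio hβ.le)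
      choose A hA hA' using fun n => ih _ (hsup n) (hcount _ (hsup n))
      refine ⟨A, hA, fun γ hγ => ?_⟩
      obtain ⟨j, hj⟩ := hf ⟨γ, hγ⟩
      refine (finite_Iio j).subset fun n hn => ?_
      by_contra hjn
      refine hA' n (iterSeqClosure_mono _ ?_ hn)
      have := Finset.le_sup (f := fun i => (f i).1)
        (Finset.mem_range.2 (Nat.lt_succ_of_le (not_lt.1 hjn)))
      rwa [hj] at this
  obtain ⟨A, hcl, hfin⟩ := hA
  let T : Set (SeqSpace F) := ⋃ n, prepend n '' A n
  have hT : ∀ n, prepend n ⁻¹' T = A n := by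
    intro n
    ext s
    simp only [T, mem_preimage, mem_iUnion]
    constructor
    · rintro ⟨m, t, ht, hts⟩
      obtain ⟨rfl, rfl⟩ := List.cons.inj hts
      exact ht
    · exact fun hs => ⟨n, s, hs, rfl⟩
  refine ⟨T, ?_, fun hmem => ?_⟩
  · by_contra hroot
    have := isClosed_iff.1 (isClosed_closure (s := T)) _ hroot
    refine empty_notMem F (mem_of_superset this fun n hn => hn ?_)
    refine closure_mono ?_ (image_closure_subset_closure_image (continuous_prepend n)
      (mem_image_of_mem (prepend n) (hcl n)))
    exact subset_iUnion (fun n => prepend n '' A n) n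
  · obtain ⟨γ, hγ, hinf⟩ := root_mem_iterSeqClosure hF hFr (by
      simp only [T, mem_iUnion, not_exists]
      rintro n ⟨t, -, ht⟩
      exact root_ne_prepend n t ht.symm) hmem
    refine hinf ((hfin γ hγ).subset fun n hn => ?_)
    have := prepend_mem_iterSeqClosure hF hFr hn
    rwa [hT] at this

theorem hasSequentialOrder [F.NeBot] (hF : F ≤ cofinite) (hFr : IsFrechetFilter F)
    (hω : ∀ α < Ordinal.omega 1, Countable (Iio (α : Ordinal.{0}))) :
    HasSequentialOrder (SeqSpace F) (Ordinal.omega 1) := by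
  have := sequentialSpace hF hFr
  refine ⟨iterSeqClosure_omega_one, fun α hα => ?_⟩
  by_contra hlt
  obtain ⟨A, h₁, h₂⟩ := exists_root_notMem_iterSeqClosure (F := F) hF hFr (hω α (not_le.1 hlt))
  exact h₂ (hα A ▸ h₁)

end SeqSpace

/-! ### The filters and their complexity -/

/-- The filter whose dual ideal is the orthogonal of `𝒜`. -/
def orthogonalFilter {X : Type*} (𝒜 : Set (Set X)) : Filter X where
  sets := {S | Sᶜ ∈ orthogonal 𝒜}
  univ_sets := finite_mem_orthogonal (by simp)
  sets_of_superset hS hST := orthogonal_anti_mem (compl_subset_compl.2 hST) hS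
  inter_sets {S T} hS hT A hA := by
    rw [compl_inter, inter_union_distrib_left]
    exact (hS A hA).union (hT A hA)

theorem dualIdeal_orthogonalFilter {X : Type*} (𝒜 : Set (Set X)) :
    dualIdeal (orthogonalFilter 𝒜) = orthogonal 𝒜 := by
  ext A
  change Aᶜᶜ ∈ orthogonal 𝒜 ↔ _
  rw [compl_compl]

theorem orthogonalFilter_le_cofinite {X : Type*} (𝒜 : Set (Set X)) :
    orthogonalFilter 𝒜 ≤ cofinite := fun _ hS =>
  finite_mem_orthogonal (mem_cofinite.1 hS)

theorem isFrechetFilter_orthogonalFilter {X : Type*} (𝒜 : Set (Set X)) :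
    IsFrechetFilter (orthogonalFilter 𝒜) := by
  rw [IsFrechetFilter, dualIdeal_orthogonalFilter, orthogonal_triple]

/-- The filter dual to the second family of the `α`-th orthogonal pair. -/
noncomputable def rankFilter (α : Ordinal.{0}) : Filter ℕ := orthogonalFilter (orthPair α).1

theorem dualIdeal_rankFilter (α : Ordinal.{0}) : dualIdeal (rankFilter α) = (orthPair α).2 := by
  rw [rankFilter, dualIdeal_orthogonalFilter, ← (isOrthPair_orthPair α).snd_eq]

theorem rankFilter_le_cofinite (α : Ordinal.{0}) : rankFilter α ≤ cofinite :=
  orthogonalFilter_le_cofinite _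

theorem isFrechetFilter_rankFilter (α : Ordinal.{0}) : IsFrechetFilter (rankFilter α) :=
  isFrechetFilter_orthogonalFilter _

instance neBot_rankFilter (α : Ordinal.{0}) : (rankFilter α).NeBot := by
  rw [← empty_mem_iff_bot.not.trans neBot_iff.symm]
  intro h
  refine univ_notMem_orthPair_snd α ?_
  rw [← dualIdeal_rankFilter, dualIdeal, mem_ofPred_eq, compl_univ]
  exact h

section Borel

variable {X : Type*}

theorem isBorelFamily_iff [Countable X] {𝒜 : Set (Set X)} : IsBorelFamily 𝒜 ↔ MeasurableSet (cubeSet 𝒜) := by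
  rw [IsBorelFamily, ← BorelSpace.measurable_eq (α := X → Bool)]

theorem IsBorelFamily.isAnalyticFamily [Countable X] {𝒜 : Set (Set X)} (h : IsBorelFamily 𝒜) :
    IsAnalyticFamily 𝒜 :=
  have : PolishSpace Bool := inferInstance
  (isBorelFamily_iff.1 h).analyticSet

theorem measurableSet_setOf_apply (x : X) (b : Bool) : MeasurableSet {χ : X → Bool | χ x = b} :=
  measurableSet_eq_fun (measurable_pi_apply x) measurable_const

theorem measurableSet_cubeSet_preimage {Y : Type*} [Countable Y] {𝒜 : Set (Set Y)}
    (h : IsBorelFamily 𝒜) (f : Y → X) :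
    MeasurableSet {χ : X → Bool | f ⁻¹' {x | χ x = true} ∈ 𝒜} :=
  (measurable_pi_lambda (fun (χ : X → Bool) y => χ (f y)) fun y => measurable_pi_apply (f y))
    (isBorelFamily_iff.1 h)

theorem measurableSet_setOf_finite {ι : Type*} [Countable ι] {p : ι → (X → Bool) → Prop}
    (hp : ∀ i, MeasurableSet {χ | p i χ}) : MeasurableSet {χ | {i | p i χ}.Finite} := by
  have : {χ | {i | p i χ}.Finite} = ⋃ s : Finset ι, ⋂ i, ⋂ (_ : i ∉ s), {χ | p i χ}ᶜ := by
    ext χ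
    simp only [mem_iUnion, mem_iInter, mem_compl_iff, mem_ofPred_eq]
    constructor
    · intro h
      exact ⟨h.toFinset, fun i hi => by simpa using hi⟩
    · rintro ⟨s, hs⟩
      exact s.finite_toSet.subset fun i hi => by_contra fun his => hs i his hi
  rw [this]
  exact .iUnion fun s => .iInter fun i => .iInter fun _ => (hp i).compl

theorem isBorelFamily_orthPair (α : Ordinal.{0}) :
    IsBorelFamily (orthPair α).1 ∧ IsBorelFamily (orthPair α).2 := by
  induction α using WellFoundedLT.induction with
  | ind α ih =>
  rcases orthPair_cases α with ⟨f, hf, -, hα⟩ | ⟨-, hα⟩ <;> rw [hα]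
  · have hsum : ∀ I : ℕ → Set (Set ℕ), (∀ n, IsBorelFamily (I n)) →
        MeasurableSet (cubeSet (columnSum I)) := fun I hI => by
      have : cubeSet (columnSum I) =
          ⋂ n, {χ | Nat.pair n ⁻¹' {x | χ x = true} ∈ I n} := by
        ext χ
        simp only [mem_iInter]
        rfl
      rw [this]
      exact .iInter fun n => measurableSet_cubeSet_preimage (hI n) _
    refine ⟨isBorelFamily_iff.2 (hsum _ fun n => (ih _ (hf n)).2), isBorelFamily_iff.2 ?_⟩
    refine (hsum _ fun n => (ih _ (hf n)).1).inter
      (measurableSet_setOf_finite (p := fun n χ => (column n {x | χ x = true}).Nonempty) fun n => ?_)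
    have : {χ : ℕ → Bool | (column n {x | χ x = true}).Nonempty} =
        ⋃ m, {χ | χ (Nat.pair n m) = true} := by
      ext χ
      simp only [mem_iUnion]
      rfl
    rw [this]
    exact .iUnion fun m => measurableSet_setOf_apply _ _
  · exact ⟨isBorelFamily_iff.2 .univ, isBorelFamily_iff.2
      (measurableSet_setOf_finite fun n => measurableSet_setOf_apply n true)⟩

theorem isBorelFamily_sets [Countable X] {F : Filter X} (h : IsBorelFamily (dualIdeal F)) :
    IsBorelFamily F.sets := by
  rw [isBorelFamily_iff] at h ⊢
  have hm : Measurable fun (χ : X → Bool) x => !(χ x) :=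
    measurable_pi_lambda _ fun x => (measurable_of_finite Bool.not).comp (measurable_pi_apply x)
  convert hm h using 1
  ext χ
  simp [cubeSet, dualIdeal, compl_ofPred]

theorem isBorelFamily_openSets {F : Filter ℕ} (h : IsBorelFamily F.sets) :
    IsBorelFamily (openSets (SeqSpace F)) := by
  rw [isBorelFamily_iff]
  have : cubeSet (openSets (SeqSpace F)) =
      ⋂ s : SeqSpace F, ({χ | χ s = true}ᶜ ∪ {χ | s.extend ⁻¹' {x | χ x = true} ∈ F.sets}) := by
    ext χ
    simp only [mem_iInter, mem_union, mem_compl_iff, ← imp_iff_not_or]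
    rfl
  rw [this]
  exact .iInter fun s => (measurableSet_setOf_apply s true).compl.union
    (measurableSet_cubeSet_preimage h _)

end Borel

/-! ### Distinguishing the spaces -/

theorem Homeomorph.mem_seqClosure_image_iff {X Y : Type*} [TopologicalSpace X] [TopologicalSpace Y]
    (e : X ≃ₜ Y) {A : Set X} {p : X} : e p ∈ seqClosure (e '' A) ↔ p ∈ seqClosure A := by
  constructor
  · rintro ⟨x, hx, hxp⟩
    refine ⟨fun n => e.symm (x n), fun n => ?_, ?_⟩
    · obtain ⟨a, ha, hax⟩ := hx n
      simpa [← hax] using ha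
    · simpa [Function.comp_def] using (e.symm.continuous.tendsto _).comp hxp
  · rintro ⟨x, hx, hxp⟩
    exact ⟨fun n => e (x n), fun n => mem_image_of_mem e (hx n), (e.continuous.tendsto _).comp hxp⟩

/-- A homeomorphism between sequence spaces induces an isomorphism of the two dual ideals, off a
set in the ideal. -/
theorem SeqSpace.exists_of_homeomorph {F G : Filter ℕ} (hF : F ≤ cofinite)
    (hFr : IsFrechetFilter F) (hG : G ≤ cofinite) (hGr : IsFrechetFilter G)
    (e : SeqSpace G ≃ₜ SeqSpace F) :
    ∃ (E : Set ℕ) (φ : ℕ → ℕ), E ∈ dualIdeal G ∧ InjOn φ Eᶜ ∧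
      ∀ A ⊆ Eᶜ, A ∈ dualIdeal G ↔ φ '' A ∈ dualIdeal F := by
  set r := root G
  -- The ideal is thus read off from sequential closure at the root, which `e` preserves.
  have hG' : ∀ A : Set ℕ, A ∈ dualIdeal G ↔ e r ∉ seqClosure (e '' (r.extend '' A)) := by
    intro A
    rw [e.mem_seqClosure_image_iff, mem_seqClosure_iff hG hGr, not_or, not_not]
    have h1 : r ∉ r.extend '' A := by
      rintro ⟨n, -, hn⟩
      exact root_ne_prepend n (root G) hn.symm
    have h2 : {n | r.extend n ∈ r.extend '' A} = A :=
      preimage_image_eq A (extend_injective r)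
    rw [h2]
    exact ⟨fun h => ⟨h1, h⟩, fun h => h.2⟩
  have hne : ∀ n, e r ≠ e (r.extend n) := fun n h =>
    root_ne_prepend n (root G) (e.injective h)
  -- `E` collects the children of the root not sent to children of `e r`; their images cannot
  -- accumulate sequentially at `e r`, so `E` is in the ideal.
  let E : Set ℕ := {n | ∀ m, e (r.extend n) ≠ (e r).extend m}
  have hE : ∀ n ∈ Eᶜ, ∃ m, e (r.extend n) = (e r).extend m := fun n hn => by
    simpa [E] using hn
  choose! φ hφ using hE
  refine ⟨E, φ, ?_, ?_, fun A hA => ?_⟩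
  · rw [hG', mem_seqClosure_iff hF hFr, not_or, not_not]
    constructor
    · rintro ⟨_, ⟨n, -, rfl⟩, hn⟩
      exact hne n hn.symm
    · refine finite_mem_dualIdeal hF (finite_empty.subset ?_)
      rintro m ⟨_, ⟨n, hn, rfl⟩, hnm⟩
      exact hn m hnm
  · intro a ha b hb hab
    refine extend_injective r (e.injective ?_)
    rw [hφ a ha, hφ b hb, hab]
  · rw [hG', mem_seqClosure_iff hF hFr, not_or, not_not]
    have h1 : e r ∉ e '' (r.extend '' A) := by
      rintro ⟨_, ⟨n, -, rfl⟩, hn⟩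
      exact hne n hn.symm
    have h2 : {m | (e r).extend m ∈ e '' (r.extend '' A)} = φ '' A := by
      ext m
      constructor
      · rintro ⟨_, ⟨n, hn, rfl⟩, hnm⟩
        refine ⟨n, hn, extend_injective (e r) ?_⟩
        rw [← hφ n (hA hn), hnm]
      · rintro ⟨n, hn, rfl⟩
        exact ⟨_, ⟨n, hn, rfl⟩, hφ n (hA hn)⟩
    rw [h2]
    exact ⟨fun h => h.2, fun h => ⟨h1, h⟩⟩

theorem isEmpty_homeomorph_rankFilter {α β : Ordinal.{0}} (hαβ : α < β)
    (hβ : β < Ordinal.omega 1) :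
    IsEmpty (SeqSpace (rankFilter β) ≃ₜ SeqSpace (rankFilter α)) := by
  refine ⟨fun e => ?_⟩
  obtain ⟨E, φ, hE, hφ, hiff⟩ := SeqSpace.exists_of_homeomorph (rankFilter_le_cofinite α)
    (isFrechetFilter_rankFilter α) (rankFilter_le_cofinite β) (isFrechetFilter_rankFilter β) e
  rw [dualIdeal_rankFilter] at hE
  simp only [dualIdeal_rankFilter] at hiff
  obtain ⟨f, hf, hinf, hβe⟩ := orthPair_eq_columnSum (ne_bot_of_gt hαβ) hβ
  have hfin : {n | (column n E).Nonempty}.Finite := by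
    rw [hβe] at hE
    exact hE.2
  obtain ⟨k, hk, hkE⟩ := hinf α hαβ |>.exists_notMem_finite hfin
  have hcol : ∀ m, Nat.pair k m ∈ Eᶜ := fun m hm => hkE ⟨m, hm⟩
  have hsub : ∀ A, Nat.pair k '' A ⊆ Eᶜ := fun A => image_subset_iff.2 fun m _ => hcol m
  have hinj : Function.Injective fun m => φ (Nat.pair k m) := fun a b hab =>
    (Nat.pair_eq_pair.1 (hφ (hcol a) (hcol b) hab)).2
  have hpair := fun n => isOrthPair_orthPair (f n)
  have himg : ∀ A, {y | ((), y) ∈ (fun m => ((), φ (Nat.pair k m))) '' A} =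
      φ '' (Nat.pair k '' A) := by
    intro A
    ext y
    simp
  have hto : ∀ A : Set ℕ, φ '' (Nat.pair k '' A) ∈ (orthPair α).2 ↔ A ∈ (orthPair α).1 := by
    intro A
    rw [← hiff _ (hsub A), hβe]
    constructor
    · intro h
      have := h.1 k
      rw [column_image_pair_self] at this
      rwa [← show f k = α from hk]
    · intro h
      exact image_pair_mem_finColumnSum hpair (by rwa [hk])
  refine not_embeds_swap α (hαβ.trans hβ) (fun _ : Unit => α) (fun _ => le_rfl)
    (fun m => ((), φ (Nat.pair k m))) (fun a b hab => hinj (Prod.ext_iff.1 hab).2) ?_ ?_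
  · intro A hA _
    rw [himg]
    exact (hto A).2 hA
  · intro A hA _
    -- The second inclusion follows from the first by orthogonality: a test set `C` in the second
    -- family pulls back into the first family, so it meets `A` in a finite set.
    rw [himg, (isOrthPair_orthPair α).fst_eq]
    intro C hC
    have hC' : (fun m => φ (Nat.pair k m)) ⁻¹' C ∈ (orthPair α).1 := by
      rw [← hto, image_image]
      exact (isOrthPair_orthPair α).symm.mono (image_preimage_subset _ _) hC
    rw [(isOrthPair_orthPair α).snd_eq] at hA
    refine ((hA _ hC').image fun m => φ (Nat.pair k m)).subset ?_
    rintro _ ⟨hyC, _, ⟨m, hm, rfl⟩, rfl⟩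
    exact ⟨m, ⟨hyC, hm⟩, rfl⟩

theorem injOn_rankFilter : InjOn rankFilter (Iio (Ordinal.omega 1)) := by
  intro α hα β hβ h
  by_contra hne
  rcases lt_or_gt_of_ne hne with hlt | hlt
  · exact (isEmpty_homeomorph_rankFilter hlt hβ).false (h ▸ Homeomorph.refl _)
  · exact (isEmpty_homeomorph_rankFilter hlt hα).false (h ▸ Homeomorph.refl _)

theorem not_countable_Iio_omega_one : ¬ (Iio (Ordinal.omega 1 : Ordinal.{0})).Countable := by
  rw [← Cardinal.le_aleph0_iff_set_countable, Cardinal.mk_Iio_ordinal, Ordinal.card_omega,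
    ← Cardinal.lift_aleph0.{1, 0}, Cardinal.lift_le, not_le]
  exact Cardinal.aleph0_lt_aleph_one

theorem corollary7p4 :
    ∃ 𝒞 : Set (Filter ℕ), ¬ 𝒞.Countable ∧
      (∀ F ∈ 𝒞,
        (F.NeBot ∧ F ≤ cofinite ∧ IsFrechetFilter F ∧
          IsAnalyticFamily F.sets ∧ IsBorelFamily F.sets) ∧
        IsAnalyticTopSpace (SeqSpace F) ∧ IsBorelTopSpace (SeqSpace F) ∧
        SequentialSpace (SeqSpace F) ∧
        HasSequentialOrder (SeqSpace F) (Ordinal.omega 1)) ∧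
      𝒞.Pairwise fun F G => IsEmpty (SeqSpace F ≃ₜ SeqSpace G) := by
  refine ⟨rankFilter '' Iio (Ordinal.omega 1), fun h => not_countable_Iio_omega_one
    (countable_of_injective_of_countable_image injOn_rankFilter h), ?_, ?_⟩
  · rintro _ ⟨α, -, rfl⟩
    have hB : IsBorelFamily (rankFilter α).sets := isBorelFamily_sets (by
      rw [dualIdeal_rankFilter]
      exact (isBorelFamily_orthPair α).2)
    have hτ := isBorelFamily_openSets hB
    have hle := rankFilter_le_cofinite α
    have hFr := isFrechetFilter_rankFilter α
    exact ⟨⟨inferInstance, hle, hFr, hB.isAnalyticFamily, hB⟩,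
      ⟨inferInstance, hτ.isAnalyticFamily⟩, ⟨inferInstance, hτ⟩,
      SeqSpace.sequentialSpace hle hFr,
      SeqSpace.hasSequentialOrder hle hFr fun _ => countable_Iio_of_lt_omega_one⟩
  · rintro _ ⟨α, hα, rfl⟩ _ ⟨β, hβ, rfl⟩ hne
    rcases lt_or_gt_of_ne fun h : α = β => hne (h ▸ rfl) with hlt | hlt
    · exact ⟨fun e => (isEmpty_homeomorph_rankFilter hlt hβ).false e.symm⟩
    · exact isEmpty_homeomorph_rankFilter hlt hα
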